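/- Let $M,N,T\ge 1$ be integers, $\rho>0$, and let $H\in\mathbb C^{N\times M}$ be a fixed channel realization. Write $H_{\mathrm{ex}}\in\mathbb C^{NT\times MT}$ for the block diagonal matrix with $T$ diagonal blocks equal to $H$. The channel is $y=H_{\mathrm{ex}}x+n$, where the $NT$ complex entries of $n$ are independent, circularly symmetric complex Gaussian with independent real and imaginary parts, each of variance $\sigma^2=\rho^{-1}/(2\pi e)$. Let $K>0$ be such that $l=KT$ is a positive integer, and let $S\subset\mathbb C^{MT}$ be a $KT$-complex-dimensional infinite constellation (IC), i.e. a set of points whose complex linear span $W$ has complex dimension $l$. Let $\mathrm{cube}(a)\subset W$ be a (possibly rotated) cube with edges of length $a$ centered at $0$, i.e. the set of vectors in $W$ whose coordinates in a fixed real orthonormal basis of $W$ have absolute value at most $a/2$, and put $M(S,a)=|S\cap \mathrm{cube}(a)|$. Assume that, for some $0\le r\le K$, the transmitter density of $S$ is $$\gamma_{\mathrm{tr}}=\limsup_{a\to\infty}\frac{M(S,a)}{a^{2KT}}=\rho^{rT},$$ and that the received constellation $S'=H_{\mathrm{ex}}S$ is also $KT$-complex dimensional (equivalently, $H_{\mathrm{ex}}$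 is injective on $W$). Let $$\gamma_{\mathrm{rc}}=\limsup_{a\to\infty}\frac{M(S,a)}{\mathrm{Vol}(H_{\mathrm{ex}}\,\mathrm{cube}(a))},\qquad \mu_{\mathrm{rc}}=\frac{\gamma_{\mathrm{rc}}^{-1/(KT)}}{2\pi e\sigma^2}$$ be the receiver density and the receiver volume-to-noise ratio, where $\mathrm{Vol}$ is the $2KT$-dimensional Euclidean volume. For $x'\in S'$ let $P_e(x',H,\rho)$ be the maximum-likelihood decoding error probability, i.e. the probability that $x'+n$ does not lie in the Voronoi region of $x'$ with respect to $S'$ (equivalently, that $x'$ is not a nearest point of $S'$ to $x'+n$), and let $$\overline{P_e}(H,\rho)=\limsup_{a\to\infty}\frac{1}{M(S,a)}\sum_{x'\in S'\cap H_{\mathrm{ex}}\mathrm{cube}(a)}P_e(x',H,\rho)$$ be the average decoding error probability. Then $$\overline{P_e}(H,\rho)>\frac{C(KT)}{4}\,e^{-\mu_{\mathrm{rc}}A(KT)+(KT-1)\ln\mu_{\mathrm{rc}}},$$ where $$A(KT)=e\,\Gamma(KT+1)^{\frac1{KT}},\qquad C(KT)=\frac{e^{KT-\frac32}\,\Gamma(KT+1)^{\frac{KT-1}{KT}}}{2\,\Gamma(KT)}.$$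 -/

import Mathlib

open MeasureTheory ProbabilityTheory Filter Set Module
open scoped ENNReal NNReal

noncomputable section

namespace MIMO

/-- Signals of `T` channel uses with `m` antennas: the vector `(x₁, …, x_T)`, `x_t ∈ ℂᵐ`, with its
Euclidean norm; the coordinate `(i, t)` is the `i`-th entry of `x_t`. -/
abbrev Signal (m T : ℕ) : Type := EuclideanSpace ℂ (Fin m × Fin T)

/-- The extended channel: the block diagonal `NT × MT` matrix with `T` blocks equal to `H`. -/
def extChannel {M N : ℕ} (T : ℕ) (H : Matrix (Fin N) (Fin M) ℂ) : Signal M T →ₗ[ℂ] Signal N T :=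
  Matrix.toEuclideanLin (Matrix.blockDiagonal fun _ : Fin T => H)

/-- The circularly symmetric complex normal law `CN(0, s)`: real and imaginary part are independent,
centered Gaussians of variance `s / 2`. -/
def complexNormal (s : ℝ≥0) : Measure ℂ :=
  ((gaussianReal 0 (s / 2)).prod (gaussianReal 0 (s / 2))).map Complex.measurableEquivRealProd.symm

/-- The law of the extended noise `ρ^{-1/2} (n₁, …, n_T)`, with `n_t ~ CN(0, 2/(2πe) I_N)`
independent. -/
def noise (N T : ℕ) (ρ : ℝ) : Measure (Signal N T) :=
  (Measure.pi fun _ : Fin N × Fin T =>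
      complexNormal (Real.toNNReal (2 / (2 * Real.pi * Real.exp 1)))).map
    fun z => ρ ^ (-(1 / 2) : ℝ) • WithLp.toLp 2 z

/-- The noise variance per real dimension. -/
def noiseVar (ρ : ℝ) : ℝ := ρ⁻¹ / (2 * Real.pi * Real.exp 1)

/-- A set of points is `l`-complex dimensional if `l` is the least dimension of a complex subspace
that contains it, i.e. the dimension of its complex span. -/
def IsComplexDim {m T : ℕ} (S : Set (Signal m T)) (l : ℕ) : Prop :=
  finrank ℂ (Submodule.span ℂ S) = l

/-- The axes `u` of a rotated cube that fills, as the edge length tends to infinity, the complex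
subspace spanned by `S`: a real orthonormal basis of this subspace. -/
def IsCubeFrame {m T d : ℕ} (S : Set (Signal m T)) (u : Fin d → Signal m T) : Prop :=
  Orthonormal ℝ u ∧
    Submodule.span ℝ (Set.range u) = (Submodule.span ℂ S).restrictScalars ℝ

/-- The cube with axes `u` and edges of length `a`, centered around zero. -/
def cube {m T d : ℕ} (u : Fin d → Signal m T) (a : ℝ) : Set (Signal m T) :=
  {x | ∃ c : Fin d → ℝ, (∀ i, |c i| ≤ a / 2) ∧ x = ∑ i, c i • u i}

/-- `M(S, a)`: the number of points of `S` in the cube of edge length `a`. -/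
def numPoints {m T d : ℕ} (S : Set (Signal m T)) (u : Fin d → Signal m T) (a : ℝ) : ℝ≥0∞ :=
  ((S ∩ cube u a).encard : ℝ≥0∞)

/-- The density at the transmitter. -/
def txDensity {m T d : ℕ} (S : Set (Signal m T)) (u : Fin d → Signal m T) : ℝ≥0∞ :=
  limsup (fun a : ℝ => numPoints S u a / ENNReal.ofReal (a ^ d)) atTop

/-- The density at the receiver; `μHE[d]` is the `d`-dimensional Euclidean volume. -/
def rxDensity {M N T d : ℕ} (H : Matrix (Fin N) (Fin M) ℂ) (S : Set (Signal M T))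
    (u : Fin d → Signal M T) : ℝ≥0∞ :=
  limsup (fun a : ℝ => numPoints S u a / μHE[d] (extChannel T H '' cube u a)) atTop

/-- The volume-to-noise ratio at the receiver, for an `l`-complex dimensional constellation. -/
def rxVNR {M N T l : ℕ} (ρ : ℝ) (H : Matrix (Fin N) (Fin M) ℂ) (S : Set (Signal M T))
    (u : Fin (2 * l) → Signal M T) : ℝ :=
  (rxDensity H S u).toReal ^ (-(1 / (l : ℝ))) / (2 * Real.pi * Real.exp 1 * noiseVar ρ)

/-- The Voronoi region of `x` with respect to `S`, in the whole signal space. It is the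
maximum-likelihood decision region of `x` for white Gaussian noise. -/
def voronoi {m T : ℕ} (S : Set (Signal m T)) (x : Signal m T) : Set (Signal m T) :=
  {y | ∀ s ∈ S, dist y x ≤ dist y s}

/-- The maximum-likelihood decoding error probability when `x ∈ S` is the noiseless received point:
some other point of `S` is strictly closer to the received point than `x` is. -/
def errorProb {N T : ℕ} (ρ : ℝ) (S : Set (Signal N T)) (x : Signal N T) : ℝ≥0∞ :=
  noise N T ρ {n | x + n ∉ voronoi S x}

/-- The average decoding error probability of `S` for the channel realization `H`. -/
def avgErrorProb {M N T d : ℕ} (ρ : ℝ) (H : Matrix (Fin N) (Fin M) ℂ) (S : Set (Signal M T))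
    (u : Fin d → Signal M T) : ℝ≥0∞ :=
  limsup (fun a : ℝ =>
    (∑' x : ↥((extChannel T H '' S) ∩ (extChannel T H '' cube u a)),
      errorProb ρ (extChannel T H '' S) (x : Signal N T)) / numPoints S u a) atTop

/-- `A(n) = e Γ(n+1)^{1/n}`. -/
def boundA (n : ℝ) : ℝ := Real.exp 1 * Real.Gamma (n + 1) ^ (1 / n)

/-- `C(n) = e^{n-3/2} Γ(n+1)^{(n-1)/n} / (2 Γ(n))`. -/
def boundC (n : ℝ) : ℝ :=
  Real.exp (n - 3 / 2) * Real.Gamma (n + 1) ^ ((n - 1) / n) / (2 * Real.Gamma n)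

end MIMO

end

/-!
The proof is a sphere bound. A maximum-likelihood decision is correct only if the noise falls into the
Voronoi cell of the transmitted point, shifted to the origin. Only the noise component in the
`2l`-dimensional real space spanned by the received points matters, and this component is isotropic
Gaussian there (`map_adjoint_noise`, by comparing characteristic functions).

Since the Gaussian density decreases with the distance from the origin, the bathtub principle
`withDensity_add_le` bounds the mass of a cell by the mass of a ball plus the density at its boundary
times the excess volume of the cell. This bound is affine in the volume, so it can be averaged over the
points of a large cube. The cells of these points, truncated at a fixed radius, are disjoint up to
null sets and lie in a slightly larger cube; hence their mean volume is, along a sequence of cubes,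
at most nearly the inverse of the density. Thus the average error probability is at least the
probability that the noise leaves the ball of volume `γ_rc⁻¹` (`le_limsup_average_error`,
`gaussLaw_compl_closedBall_le_avgErrorProb`).

The last probability is `exp (-t) ∑_{i < l} t ^ i / i!` with `t = μ_rc A(l)`. Its term with `i = l - 1`
alone (`gaussLaw_compl_closedBall_ge`) exceeds the claimed bound by the factor `8 exp (1 / 2)`
(`bound_lt`), which also makes the inequality strict.
-/

namespace MIMO

/-! ### Voronoi cells and the bathtub principle -/

/-- Bathtub principle: among sets of the same volume, a superlevel set `B` of the density carries the
most mass. The level `κ` prices volume, so that sets of different volume can be compared. -/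
theorem withDensity_add_le {α : Type*} [MeasurableSpace α] {μ : Measure α} {φ : α → ℝ≥0∞}
    {κ : ℝ≥0∞} {B s : Set α} (hB : MeasurableSet B) (hs : MeasurableSet s)
    (hin : ∀ z ∈ B, κ ≤ φ z) (hout : ∀ z ∉ B, φ z ≤ κ) :
    μ.withDensity φ s + κ * μ B ≤ μ.withDensity φ B + κ * μ s := by
  set ν := μ.withDensity φ with hν
  have h1 : ν (s \ B) ≤ κ * μ (s \ B) := by
    rw [hν, withDensity_apply _ (hs.diff hB), ← setLIntegral_const]
    exact setLIntegral_mono measurable_const fun z hz => hout z hz.2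
  have h2 : κ * μ (B \ s) ≤ ν (B \ s) := by
    rw [hν, withDensity_apply _ (hB.diff hs), ← setLIntegral_const]
    exact setLIntegral_mono' (hB.diff hs) fun z hz => hin z hz.1
  rw [← measure_inter_add_sdiff s hB, ← measure_inter_add_sdiff (μ := μ) B hs,
    ← measure_inter_add_sdiff (μ := ν) B hs, ← measure_inter_add_sdiff (μ := μ) s hB,
    inter_comm B s, mul_add, mul_add]
  calc _ = (ν (s ∩ B) + κ * μ (s ∩ B)) + (ν (s \ B) + κ * μ (B \ s)) := by ring
    _ ≤ (ν (s ∩ B) + κ * μ (s ∩ B)) + (κ * μ (s \ B) + ν (B \ s)) := by gcongr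
    _ = _ := by ring

section Packing

variable {V : Type*} [NormedAddCommGroup V]

/-- The closed Voronoi region of `x` with respect to `X`: the points that have no point of `X`
strictly closer than `x`. -/
def voronoiCell (X : Set V) (x : V) : Set V :=
  {y | ∀ s ∈ X, dist y x ≤ dist y s}

theorem isClosed_voronoiCell (X : Set V) (x : V) : IsClosed (voronoiCell X x) := by
  simp only [voronoiCell, ofPred_forall]
  exact isClosed_biInter fun s _ =>
    isClosed_le (continuous_id.dist continuous_const) (continuous_id.dist continuous_const)

variable [InnerProductSpace ℝ V] [FiniteDimensional ℝ V] [MeasurableSpace V] [BorelSpace V]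

/-- Two closed Voronoi regions meet in a part of a bisecting hyperplane. -/
theorem aedisjoint_voronoiCell {X : Set V} {x y : V} (hx : x ∈ X) (hy : y ∈ X) (hxy : x ≠ y) :
    AEDisjoint volume (voronoiCell X x) (voronoiCell X y) := by
  refine measure_mono_null (t := (AffineSubspace.perpBisector x y : Set V)) ?_
    (Measure.addHaar_affineSubspace _ _ ?_)
  · rintro z ⟨h1, h2⟩
    exact AffineSubspace.mem_perpBisector_iff_dist_eq.2 (le_antisymm (h1 y hy) (h2 x hx))
  · intro h
    have : x ∈ AffineSubspace.perpBisector x y := h ▸ AffineSubspace.mem_top ℝ V x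
    rw [AffineSubspace.mem_perpBisector_iff_dist_eq] at this
    simp at this
    exact hxy this

/-- Lower bound for the total error of finitely many points `t` of `X`. The Voronoi cells are
truncated at radius `R`, so that they lie in `G`; being disjoint up to null sets, they have volumes
that add up to at most that of `G`. The mass lost by truncating is the second summand on the right. -/
theorem sum_voronoiCell_error_ge {φ : V → ℝ≥0∞} {κ : ℝ≥0∞} {B : Set V} (hB : MeasurableSet B)
    [IsProbabilityMeasure ((volume : Measure V).withDensity φ)]
    (hin : ∀ z ∈ B, κ ≤ φ z) (hout : ∀ z ∉ B, φ z ≤ κ) {X G : Set V} {t : Finset V}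
    (ht : (t : Set V) ⊆ X) {R : ℝ} (hG : ∀ x ∈ t, Metric.closedBall x R ⊆ G) :
    t.card * ((volume : Measure V).withDensity φ Bᶜ + κ * volume B) ≤
      ∑ x ∈ t, (volume : Measure V).withDensity φ {z | x + z ∉ voronoiCell X x} +
        t.card * (volume : Measure V).withDensity φ (Metric.closedBall 0 R)ᶜ + κ * volume G := by
  set ν := (volume : Measure V).withDensity φ with hν
  let c : V → Set V := fun x => {z | x + z ∈ voronoiCell X x} ∩ Metric.closedBall 0 R
  have hcm : ∀ x, MeasurableSet (c x) := fun x =>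
    (((isClosed_voronoiCell X x).preimage (continuous_const.add continuous_id)).inter
      Metric.isClosed_closedBall).measurableSet
  have hvol : ∑ x ∈ t, volume (c x) ≤ volume G := by
    -- Truncated cells are translated back to their own points.
    have htr : ∀ x, volume (c x) = volume (voronoiCell X x ∩ Metric.closedBall x R) := by
      intro x
      rw [← measure_preimage_add volume x (voronoiCell X x ∩ Metric.closedBall x R)]
      congr 1
      ext z
      simp [c]
    simp only [htr]
    rw [← measure_biUnion_finset₀]
    · exact measure_mono (iUnion₂_subset fun x hx => inter_subset_right.trans (hG x hx))
    · intro x hx y hy hxy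
      exact (aedisjoint_voronoiCell (ht hx) (ht hy) hxy).mono inter_subset_left inter_subset_left
    · exact fun x _ => ((isClosed_voronoiCell X x).inter
        Metric.isClosed_closedBall).measurableSet.nullMeasurableSet
  -- A correct decision means that the noise is in the truncated cell or longer than `R`.
  have hone : ∀ x, ν B + ν Bᶜ ≤
      ν {z | x + z ∉ voronoiCell X x} + ν (Metric.closedBall 0 R)ᶜ + ν (c x) := by
    intro x
    rw [measure_add_measure_compl hB, ← measure_add_measure_compl (μ := ν) (hcm x), add_comm]
    gcongr
    rw [compl_inter]
    exact measure_union_le _ _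
  have hpt : ∀ x ∈ t, ν Bᶜ + κ * volume B ≤
      ν {z | x + z ∉ voronoiCell X x} + ν (Metric.closedBall 0 R)ᶜ + κ * volume (c x) := by
    intro x _
    refine (ENNReal.add_le_add_iff_left (measure_ne_top ν B)).1 ?_
    calc ν B + (ν Bᶜ + κ * volume B) = (ν B + ν Bᶜ) + κ * volume B := by ring
      _ ≤ (ν {z | x + z ∉ voronoiCell X x} + ν (Metric.closedBall 0 R)ᶜ + ν (c x)) +
            κ * volume B := by gcongr ?_ + _; exact hone x
      _ = (ν {z | x + z ∉ voronoiCell X x} + ν (Metric.closedBall 0 R)ᶜ) +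
            (ν (c x) + κ * volume B) := by ring
      _ ≤ (ν {z | x + z ∉ voronoiCell X x} + ν (Metric.closedBall 0 R)ᶜ) +
            (ν B + κ * volume (c x)) := by
          gcongr _ + ?_
          exact withDensity_add_le hB (hcm x) hin hout
      _ = _ := by ring
  have := Finset.sum_le_sum hpt
  simp only [Finset.sum_const, nsmul_eq_mul, Finset.sum_add_distrib, ← Finset.mul_sum] at this
  exact this.trans (by gcongr)

/-- If the density `n / v` has upper limit `β⁻¹` and enlarging the window by `c` does not change its
volume asymptotically, then for arbitrarily large windows the enlarged window offers a volume of at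
most `β + δ` per point. -/
theorem frequently_volume_div_le {n v : ℝ → ℝ≥0∞} {c : ℝ} {β δ : ℝ≥0∞}
    (hlim : limsup (fun a => n a / v a) atTop = β⁻¹) (hβ : β ≠ 0) (hβ' : β ≠ ⊤) (hδ : δ ≠ 0)
    (hδ' : δ ≠ ⊤)
    (hv0 : ∀ᶠ a in atTop, v a ≠ 0) (hv1 : ∀ a, v a ≠ ⊤)
    (hv : Tendsto (fun a => v (a + c) / v a) atTop (nhds 1)) :
    ∃ᶠ a in atTop, n a ≠ 0 ∧ n a ≠ ⊤ ∧ v (a + c) / n a ≤ β + δ := by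
  have hlt : (β + δ)⁻¹ < β⁻¹ := ENNReal.inv_lt_inv.2 (ENNReal.lt_add_right hβ' hδ)
  obtain ⟨g, hg1, hg2⟩ := exists_between hlt
  have hg0 : g ≠ 0 := (bot_le.trans_lt hg1).ne'
  have hgt : g ≠ ⊤ := (hg2.trans_le le_top).ne
  have h1 : ∃ᶠ a in atTop, g < n a / v a := frequently_lt_of_lt_limsup (by isBoundedDefault)
    (hlim ▸ hg2)
  have h2 : ∀ᶠ a in atTop, n a / v a < ⊤ :=
    eventually_lt_of_limsup_lt (by rw [hlim]; simpa [pos_iff_ne_zero] using hβ)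
  have hone : 1 < (β + δ) * g := by
    have := ENNReal.mul_lt_mul_right (a := β + δ) (by simp [hβ]) (by simp [hβ', hδ']) hg1
    rwa [ENNReal.mul_inv_cancel (by simp [hβ]) (by simp [hβ', hδ'])] at this
  have h3 : ∀ᶠ a in atTop, v (a + c) / v a < (β + δ) * g := hv.eventually_lt_const hone
  refine (h1.and_eventually (h2.and (h3.and hv0))).mono ?_
  rintro a ⟨h1, h2, h3, h4⟩
  have hn0 : n a ≠ 0 := by rintro h; simp [h] at h1
  have hn1 : n a ≠ ⊤ := by rintro h; rw [h, ENNReal.top_div_of_ne_top (hv1 a)] at h2; simp at h2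
  refine ⟨hn0, hn1, ?_⟩
  rw [ENNReal.div_le_iff hn0 hn1]
  rw [ENNReal.lt_div_iff_mul_lt (.inl h4) (.inl (hv1 a))] at h1
  rw [ENNReal.div_lt_iff (.inl h4) (.inl (hv1 a))] at h3
  calc v (a + c) ≤ (β + δ) * g * v a := h3.le
    _ = (β + δ) * (g * v a) := by ring
    _ ≤ _ := by gcongr

/-- Sphere bound for constellations: if `B` is a superlevel set of the noise density whose volume is
the volume per point of `X`, the average error probability is at least the probability that the noise
leaves `B`. No regularity of `X` is needed, since the average is compared along those windows on which
the upper limit defining the density of `X` is nearly attained. -/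
theorem le_limsup_average_error {φ : V → ℝ≥0∞} {κ : ℝ≥0∞} {B : Set V} (hB : MeasurableSet B)
    [IsProbabilityMeasure ((volume : Measure V).withDensity φ)]
    (hin : ∀ z ∈ B, κ ≤ φ z) (hout : ∀ z ∉ B, φ z ≤ κ) (hκ : κ ≠ ⊤)
    (hB0 : volume B ≠ 0) (hB1 : volume B ≠ ⊤) (X : Set V) (F : ℝ → Set V)
    (hF : ∀ R, ∃ c, ∀ a, ∀ x ∈ F a, Metric.closedBall x R ⊆ F (a + c))
    (hF0 : ∀ᶠ a in atTop, volume (F a) ≠ 0) (hF1 : ∀ a, volume (F a) ≠ ⊤)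
    (hFv : ∀ c, Tendsto (fun a => volume (F (a + c)) / volume (F a)) atTop (nhds 1))
    (hlim : limsup (fun a => ((X ∩ F a).encard : ℝ≥0∞) / volume (F a)) atTop = (volume B)⁻¹) :
    (volume : Measure V).withDensity φ Bᶜ ≤
      limsup (fun a => (∑' x : ↥(X ∩ F a),
        (volume : Measure V).withDensity φ {z | (x : V) + z ∉ voronoiCell X x}) /
          ((X ∩ F a).encard : ℝ≥0∞)) atTop := by
  set ν := (volume : Measure V).withDensity φ with hν
  refine ENNReal.le_of_forall_pos_le_add fun ε hε _ => ?_
  have hε2 : (ε : ℝ≥0∞) / 2 ≠ 0 := by simpa using hε.ne'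
  -- `R` controls the truncation error, `δ` the excess volume per point.
  obtain ⟨R, hR⟩ : ∃ R : ℝ, ν (Metric.closedBall 0 R)ᶜ ≤ ε / 2 := by
    have := tendsto_measure_compl_closedBall_of_isTightMeasureSet
      (isTightMeasureSet_singleton (μ := ν)) (0 : V)
    simp only [mem_singleton_iff, iSup_iSup_eq_left] at this
    exact ((this.eventually_le_const (pos_iff_ne_zero.2 hε2))).exists
  obtain ⟨δ, hδ0, hδ⟩ : ∃ δ : ℝ≥0∞, δ ≠ 0 ∧ δ ≠ ⊤ ∧ κ * δ ≤ ε / 2 := by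
    refine ⟨ε / 2 / (κ + 1), ?_, ?_, ?_⟩
    · simp [hε.ne', hκ]
    · exact ENNReal.div_ne_top (ENNReal.div_ne_top (by simp) (by simp)) (by simp)
    · calc κ * (ε / 2 / (κ + 1)) ≤ (κ + 1) * (ε / 2 / (κ + 1)) := by gcongr; simp
        _ = ε / 2 := ENNReal.mul_div_cancel (by simp) (by simp [hκ])
  obtain ⟨c, hc⟩ := hF R
  have hκB : κ * volume B ≠ ⊤ := ENNReal.mul_ne_top hκ hB1
  rw [← ENNReal.add_le_add_iff_right hκB, add_assoc, ← tsub_le_iff_right]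
  refine le_limsup_of_frequently_le ((frequently_volume_div_le hlim hB0 hB1 hδ0 hδ.1 hF0 hF1
    (hFv c)).mono ?_)
  rintro a ⟨hn0, hn1, hna⟩
  rw [tsub_le_iff_right]
  have hfin : (X ∩ F a).Finite := by
    rw [← encard_ne_top_iff]
    intro h
    simp [h] at hn1
  obtain ⟨t, ht⟩ := hfin.exists_finset_coe
  rw [← ht] at hn0 hn1 hna ⊢
  have hcard : (((t : Set V).encard : ℕ∞) : ℝ≥0∞) = t.card := by simp
  rw [hcard] at hn0 hn1 hna ⊢
  have key := sum_voronoiCell_error_ge (φ := φ) hB hin hout (X := X) (G := F (a + c)) (t := t)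
    (ht ▸ inter_subset_left) (R := R) fun x hx => hc a x (by
      have : x ∈ (t : Set V) := hx
      rw [ht] at this; exact this.2)
  have hsum : (∑' x : ↥(t : Set V), ν {z | (x : V) + z ∉ voronoiCell X x}) =
      ∑ x ∈ t, ν {z | x + z ∉ voronoiCell X x} :=
    Finset.tsum_subtype t fun x => ν {z | x + z ∉ voronoiCell X x}
  rw [hsum]
  rw [← hν] at key
  generalize (∑ x ∈ t, ν {z | x + z ∉ voronoiCell X x}) = e at key ⊢
  rw [mul_comm, ← ENNReal.le_div_iff_mul_le (.inl hn0) (.inl hn1), ENNReal.add_div,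
    ENNReal.add_div, mul_comm (t.card : ℝ≥0∞), ENNReal.mul_div_cancel_right hn0 hn1,
    mul_div_assoc] at key
  refine key.trans ?_
  calc _ ≤ e / t.card + ε / 2 + κ * (volume B + δ) := by gcongr
    _ = e / t.card + (ε / 2 + κ * δ + κ * volume B) := by ring
    _ ≤ e / t.card + (ε / 2 + ε / 2 + κ * volume B) := by gcongr; exact hδ.2
    _ = _ := by rw [ENNReal.add_halves]

end Packing

/-! ### The Gaussian noise and its projections -/

theorem charFun_complexNormal (s : ℝ≥0) (t : ℂ) :
    charFun (complexNormal s) t = Complex.exp (-(s * ‖t‖ ^ 2 / 4 : ℝ)) := by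
  have h : ∀ p : ℝ × ℝ, Complex.exp (inner ℝ (Complex.measurableEquivRealProd.symm p) t *
      Complex.I) = Complex.exp (t.re * p.1 * Complex.I) * Complex.exp (t.im * p.2 * Complex.I) := by
    rintro ⟨x, y⟩
    rw [← Complex.exp_add]
    congr 1
    simp [Complex.measurableEquivRealProd, Complex.inner]
    ring
  rw [charFun_apply, complexNormal, integral_map_equiv]
  simp_rw [h]
  rw [integral_prod_mul (fun x : ℝ => Complex.exp (t.re * x * Complex.I))
    (fun y : ℝ => Complex.exp (t.im * y * Complex.I)), ← charFun_apply_real, ← charFun_apply_real,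
    charFun_gaussianReal, charFun_gaussianReal, ← Complex.exp_add, Complex.sq_norm,
    Complex.normSq_apply]
  congr 1
  push_cast
  ring

instance isProbabilityMeasure_complexNormal (s : ℝ≥0) : IsProbabilityMeasure (complexNormal s) :=
  Measure.isProbabilityMeasure_map (by fun_prop)

instance isProbabilityMeasure_noise (N T : ℕ) (ρ : ℝ) : IsProbabilityMeasure (noise N T ρ) :=
  Measure.isProbabilityMeasure_map (by fun_prop)

theorem charFun_noise (N T : ℕ) {ρ : ℝ} (hρ : 0 < ρ) (t : Signal N T) :
    charFun (noise N T ρ) t =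
      Complex.exp (-(‖t‖ ^ 2 / (4 * (Real.pi * Real.exp 1 * ρ)) : ℝ)) := by
  rw [noise, charFun_map_smul_comp (by fun_prop), charFun_pi]
  simp_rw [charFun_complexNormal]
  rw [← Complex.exp_sum]
  congr 1
  have hpow : (ρ ^ (-(1 / 2) : ℝ)) ^ 2 = ρ⁻¹ := by
    rw [← Real.rpow_natCast, ← Real.rpow_mul hρ.le]
    norm_num
    exact Real.rpow_neg_one ρ
  rw [EuclideanSpace.norm_sq_eq]
  rw [Real.coe_toNNReal _ (by positivity)]
  simp only [PiLp.smul_apply, norm_smul, mul_pow, Real.norm_eq_abs, sq_abs, hpow]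
  norm_cast
  rw [Finset.sum_neg_distrib, Finset.sum_div]
  congr 1
  refine Finset.sum_congr rfl fun i _ => ?_
  field_simp

section GaussLaw

/-- The density `(b / π) ^ (dim V / 2) exp (-b ‖z‖²)` of the centered isotropic Gaussian on `V` with
variance `1 / (2 b)` in each real direction. -/
noncomputable def gaussDensity (V : Type*) [NormedAddCommGroup V] [InnerProductSpace ℝ V]
    (b : ℝ) (z : V) : ℝ :=
  (b / Real.pi) ^ (finrank ℝ V / 2 : ℝ) * Real.exp (-b * ‖z‖ ^ 2)

variable {V : Type*} [NormedAddCommGroup V] [InnerProductSpace ℝ V]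

theorem gaussDensity_nonneg {b : ℝ} (hb : 0 < b) (z : V) : 0 ≤ gaussDensity V b z := by
  unfold gaussDensity; positivity

theorem continuous_gaussDensity (b : ℝ) : Continuous (gaussDensity V b) := by
  unfold gaussDensity; fun_prop

variable [FiniteDimensional ℝ V] [MeasurableSpace V] [BorelSpace V]

theorem integral_gaussDensity {b : ℝ} (hb : 0 < b) : ∫ z, gaussDensity V b z = 1 := by
  simp only [gaussDensity]
  rw [integral_const_mul, GaussianFourier.integral_rexp_neg_mul_sq_norm hb,
    ← Real.mul_rpow (by positivity) (by positivity), div_mul_div_cancel₀ Real.pi_ne_zero,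
    div_self hb.ne', Real.one_rpow]

theorem integrable_gaussDensity {b : ℝ} (hb : 0 < b) : Integrable (gaussDensity V b) := by
  -- A function that is not integrable would have integral zero.
  refine not_imp_comm.1 integral_undef ?_
  rw [integral_gaussDensity hb]
  exact one_ne_zero

/-- The centered isotropic Gaussian law on `V` with density `gaussDensity V b`. -/
noncomputable def gaussLaw (V : Type*) [NormedAddCommGroup V] [InnerProductSpace ℝ V]
    [FiniteDimensional ℝ V] [MeasurableSpace V] [BorelSpace V] (b : ℝ) : Measure V :=
  volume.withDensity fun z => ENNReal.ofReal (gaussDensity V b z)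

theorem isProbabilityMeasure_gaussLaw {b : ℝ} (hb : 0 < b) :
    IsProbabilityMeasure (gaussLaw V b) := by
  constructor
  rw [gaussLaw, withDensity_apply _ MeasurableSet.univ, Measure.restrict_univ,
    ← ofReal_integral_eq_lintegral_ofReal (integrable_gaussDensity hb)
      (ae_of_all _ (gaussDensity_nonneg hb)), integral_gaussDensity hb, ENNReal.ofReal_one]

theorem charFun_gaussLaw {b : ℝ} (hb : 0 < b) (t : V) :
    charFun (gaussLaw V b) t = Complex.exp (-(‖t‖ ^ 2 / (4 * b) : ℝ)) := by
  rw [charFun_apply, gaussLaw, integral_withDensity_eq_integral_toReal_smul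
    (continuous_gaussDensity b).measurable.ennreal_ofReal (ae_of_all _ fun _ => by simp)]
  have h : ∀ x : V, (ENNReal.ofReal (gaussDensity V b x)).toReal •
      Complex.exp (inner ℝ x t * Complex.I) =
      ((b / Real.pi) ^ (finrank ℝ V / 2 : ℝ) : ℝ) *
        Complex.exp (-b * ‖x‖ ^ 2 + Complex.I * inner ℝ t x) := by
    intro x
    rw [ENNReal.toReal_ofReal (gaussDensity_nonneg hb x), Complex.exp_add, real_inner_comm,
      gaussDensity, Complex.real_smul]
    push_cast
    rw [mul_comm Complex.I]
    ring
  simp_rw [h]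
  rw [integral_const_mul, GaussianFourier.integral_cexp_neg_mul_sq_norm_add (by simpa using hb),
    ← mul_assoc]
  have h1 : ((Real.pi : ℂ) / b) ^ ((finrank ℝ V : ℂ) / 2) =
      (((Real.pi / b) ^ (finrank ℝ V / 2 : ℝ) : ℝ) : ℂ) := by
    rw [Complex.ofReal_cpow (by positivity)]
    push_cast
    rfl
  rw [h1, ← Complex.ofReal_mul, ← Real.mul_rpow (by positivity) (by positivity),
    div_mul_div_cancel₀ Real.pi_ne_zero, div_self hb.ne', Real.one_rpow]
  simp
  ring_nf

/-- The component of the noise in a real subspace of the signal space, in orthonormal coordinates `j`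
of the subspace, is again isotropic Gaussian with the same variance per real dimension. -/
theorem map_adjoint_noise {N T : ℕ} {ρ : ℝ} (hρ : 0 < ρ) (j : V →ₗᵢ[ℝ] Signal N T) :
    (noise N T ρ).map (ContinuousLinearMap.adjoint j.toContinuousLinearMap) =
      gaussLaw V (Real.pi * Real.exp 1 * ρ) := by
  have hb : 0 < Real.pi * Real.exp 1 * ρ := by positivity
  have := isProbabilityMeasure_gaussLaw (V := V) hb
  refine Measure.ext_of_charFun (funext fun t => ?_)
  rw [charFun_gaussLaw hb, charFun_apply, integral_map (by fun_prop) (by fun_prop)]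
  simp_rw [ContinuousLinearMap.adjoint_inner_left]
  rw [← charFun_apply, charFun_noise N T hρ]
  simp

end GaussLaw

/-! ### The radial tail of the Gaussian law -/

theorem integral_Ioi_mul_exp_neg_mul_sq {b : ℝ} (hb : 0 < b) (r : ℝ) :
    ∫ y in Ioi r, y * Real.exp (-b * y ^ 2) = Real.exp (-b * r ^ 2) / (2 * b) := by
  have hderiv : ∀ y ∈ Ici r, HasDerivAt (fun y => -(Real.exp (-b * y ^ 2) / (2 * b)))
      (y * Real.exp (-b * y ^ 2)) y := by
    intro y _
    have h := ((((hasDerivAt_id y).pow 2).const_mul (-b)).exp.div_const (2 * b)).neg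
    simp only [id, Nat.cast_ofNat, Pi.pow_apply] at h
    convert! h using 1
    simp only [mul_one]
    field_simp
    ring
  have htend : Tendsto (fun y : ℝ => -(Real.exp (-b * y ^ 2) / (2 * b))) atTop (nhds 0) := by
    have h1 : Tendsto (fun y : ℝ => -b * y ^ 2) atTop atBot :=
      (tendsto_pow_atTop two_ne_zero).const_mul_atTop_of_neg (neg_lt_zero.2 hb)
    simpa using ((Real.tendsto_exp_atBot.comp h1).div_const (2 * b)).neg
  rw [integral_Ioi_of_hasDerivAt_of_tendsto' hderiv
    (integrable_mul_exp_neg_mul_sq hb).integrableOn htend]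
  ring

/-- Lower bound for the radial tail in real dimension `2 (k + 1)`. The tail is
`exp (-t) ∑_{i ≤ k} t ^ i / i!` with `t = b r ^ 2`, of which the top term is kept: it arises by bounding
`y ^ (2 k)` below by `r ^ (2 k)` in the radial integral. -/
theorem gaussLaw_compl_closedBall_ge {V : Type*} [NormedAddCommGroup V] [InnerProductSpace ℝ V]
    [FiniteDimensional ℝ V] [MeasurableSpace V] [BorelSpace V] {k : ℕ}
    (hV : finrank ℝ V = 2 * (k + 1)) {b r : ℝ} (hb : 0 < b) (hr : 0 ≤ r) :
    ENNReal.ofReal (Real.exp (-(b * r ^ 2)) * (b * r ^ 2) ^ k / k.factorial) ≤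
      gaussLaw V b (Metric.closedBall 0 r)ᶜ := by
  have hnt : Nontrivial V := Module.nontrivial_of_finrank_pos (R := ℝ) (by omega)
  have hset : MeasurableSet (Metric.closedBall (0 : V) r)ᶜ :=
    Metric.isClosed_closedBall.measurableSet.compl
  have hc : (b / Real.pi) ^ (finrank ℝ V / 2 : ℝ) = (b / Real.pi) ^ (k + 1) := by
    rw [hV, ← Real.rpow_natCast]
    congr 1
    push_cast
    ring
  have hball : (volume : Measure V).real (Metric.ball 0 1) =
      Real.pi ^ (k + 1) / (k + 1).factorial := by
    rw [measureReal_def, InnerProductSpace.volume_ball_of_dim_even hV]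
    simp
    positivity
  rw [gaussLaw, withDensity_apply _ hset, ← ofReal_integral_eq_lintegral_ofReal
    (integrable_gaussDensity hb).integrableOn (ae_of_all _ (gaussDensity_nonneg hb))]
  refine ENNReal.ofReal_le_ofReal ?_
  have hrad : ∫ z in (Metric.closedBall (0 : V) r)ᶜ, gaussDensity V b z =
      ∫ z : V, (Ioi r).indicator
        (fun y => (b / Real.pi) ^ (k + 1) * Real.exp (-b * y ^ 2)) ‖z‖ := by
    rw [← integral_indicator hset]
    congr 1 with z
    simp only [indicator, mem_compl_iff, Metric.mem_closedBall, dist_zero_right, not_le, mem_Ioi,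
      gaussDensity, hc]
  rw [hrad, integral_fun_norm_addHaar, hball, hV]
  have hint : ∫ y in Ioi (0 : ℝ), y ^ (2 * (k + 1) - 1) • (Ioi r).indicator
        (fun y => (b / Real.pi) ^ (k + 1) * Real.exp (-b * y ^ 2)) y =
      ∫ y in Ioi r, y ^ (2 * k + 1) * ((b / Real.pi) ^ (k + 1) * Real.exp (-b * y ^ 2)) := by
    rw [← integral_indicator measurableSet_Ioi, ← integral_indicator measurableSet_Ioi]
    congr 1 with y
    simp only [indicator, mem_Ioi, smul_eq_mul]
    by_cases h : r < y
    · simp [h, hr.trans_lt h, show 2 * (k + 1) - 1 = 2 * k + 1 by omega]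
    · simp [h]
  have hle : (b / Real.pi) ^ (k + 1) * r ^ (2 * k) * (Real.exp (-b * r ^ 2) / (2 * b)) ≤
      ∫ y in Ioi r, y ^ (2 * k + 1) * ((b / Real.pi) ^ (k + 1) * Real.exp (-b * y ^ 2)) := by
    rw [← integral_Ioi_mul_exp_neg_mul_sq hb, ← integral_const_mul]
    refine setIntegral_mono_on ((integrable_mul_exp_neg_mul_sq hb).const_mul _).integrableOn ?_
      measurableSet_Ioi ?_
    · have h := (integrable_rpow_mul_exp_neg_mul_sq hb (s := (2 * k + 1 : ℕ))
        (by have : (0 : ℝ) ≤ (2 * k + 1 : ℕ) := Nat.cast_nonneg _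
            linarith)).const_mul ((b / Real.pi) ^ (k + 1))
      simp only [Real.rpow_natCast] at h
      refine (h.congr (ae_of_all _ fun y => ?_)).integrableOn
      simp only
      ring
    · intro y hy
      have hy' : r ≤ y := le_of_lt hy
      have h0 : 0 ≤ y := hr.trans hy'
      calc (b / Real.pi) ^ (k + 1) * r ^ (2 * k) * (y * Real.exp (-b * y ^ 2))
          ≤ (b / Real.pi) ^ (k + 1) * y ^ (2 * k) * (y * Real.exp (-b * y ^ 2)) := by gcongr
        _ = _ := by ring
  rw [hint, nsmul_eq_mul, smul_eq_mul]
  refine le_trans (le_of_eq ?_) (mul_le_mul_of_nonneg_left (mul_le_mul_of_nonneg_left hle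
    (by positivity)) (by positivity))
  rw [Nat.factorial_succ]
  have := Real.pi_ne_zero
  push_cast
  rw [div_pow, neg_mul, mul_pow, ← pow_mul]
  field_simp
  ring

/-- The top term of the radial tail at `t = m * boundA` is `8 exp (1 / 2)` times the left-hand
side. -/
theorem bound_lt {k : ℕ} {t m : ℝ} (hm : 0 < m)
    (ht : t = m * boundA ((k + 1 : ℕ) : ℝ)) :
    boundC ((k + 1 : ℕ) : ℝ) / 4 * Real.exp (-m * boundA ((k + 1 : ℕ) : ℝ) +
        (((k + 1 : ℕ) : ℝ) - 1) * Real.log m) <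
      Real.exp (-t) * t ^ k / k.factorial := by
  have hk : (((k + 1 : ℕ) : ℝ) - 1) = k := by push_cast; ring
  have hG : Real.Gamma ((k + 1 : ℕ) : ℝ) = k.factorial := by
    push_cast; exact Real.Gamma_nat_eq_factorial k
  have hG1 : 0 < Real.Gamma (((k + 1 : ℕ) : ℝ) + 1) := Real.Gamma_pos_of_pos (by positivity)
  have hlog : Real.exp ((k : ℝ) * Real.log m) = m ^ k := by
    rw [mul_comm, ← Real.rpow_def_of_pos hm, Real.rpow_natCast]
  have hApow : boundA ((k + 1 : ℕ) : ℝ) ^ k = Real.exp k *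
      Real.Gamma (((k + 1 : ℕ) : ℝ) + 1) ^ ((k : ℝ) / ((k + 1 : ℕ) : ℝ)) := by
    rw [boundA, mul_pow, ← Real.exp_nat_mul, mul_one, ← Real.rpow_natCast (_ ^ (1 / _)),
      ← Real.rpow_mul hG1.le]
    congr 2
    ring
  rw [ht, mul_pow, hApow, boundC, hG, hk, Real.exp_add, hlog, neg_mul]
  set g := Real.Gamma (((k + 1 : ℕ) : ℝ) + 1) ^ ((k : ℝ) / ((k + 1 : ℕ) : ℝ)) with hg
  have hgpos : 0 < g := Real.rpow_pos_of_pos hG1 _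
  have he : Real.exp (((k + 1 : ℕ) : ℝ) - 3 / 2) < 8 * Real.exp k := by
    have : Real.exp (((k + 1 : ℕ) : ℝ) - 3 / 2) < Real.exp k := by
      apply Real.exp_lt_exp.2
      push_cast
      linarith
    have h2 := Real.exp_pos (k : ℝ)
    linarith
  set E := Real.exp (-(m * boundA ((k + 1 : ℕ) : ℝ)))
  have hE : 0 < E := Real.exp_pos _
  have hf : (0 : ℝ) < k.factorial := by positivity
  calc _ = (E * m ^ k * g / (8 * k.factorial)) * Real.exp (((k + 1 : ℕ) : ℝ) - 3 / 2) := by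
        field_simp; ring
    _ < (E * m ^ k * g / (8 * k.factorial)) * (8 * Real.exp k) := by gcongr
    _ = _ := by field_simp

/-! ### From the channel to coordinates of the received constellation -/

/-- The cube of edge length `a` centered at zero in coordinate space. -/
def coordCube (d : ℕ) (a : ℝ) : Set (EuclideanSpace ℝ (Fin d)) := {c | ∀ i, |c i| ≤ a / 2}

theorem volume_coordCube (d : ℕ) (a : ℝ) : volume (coordCube d a) = ENNReal.ofReal a ^ d := by
  have h : coordCube d a = (WithLp.ofLp : EuclideanSpace ℝ (Fin d) → Fin d → ℝ) ⁻¹'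
      (univ.pi fun _ => Icc (-(a / 2)) (a / 2)) := by
    ext c
    simp only [coordCube, mem_ofPred_eq, mem_preimage, mem_univ_pi, mem_Icc, abs_le]
  rw [h, (PiLp.volume_preserving_ofLp (Fin d)).measure_preimage
    (MeasurableSet.univ_pi fun _ => measurableSet_Icc).nullMeasurableSet, volume_pi_pi]
  simp

theorem volume_image_coordCube {d : ℕ}
    (L : EuclideanSpace ℝ (Fin d) →ₗ[ℝ] EuclideanSpace ℝ (Fin d)) (a : ℝ) :
    volume (L '' coordCube d a) = ENNReal.ofReal |LinearMap.det L| * ENNReal.ofReal a ^ d := by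
  rw [Measure.addHaar_image_linearMap, volume_coordCube]

theorem closedBall_subset_image_coordCube {d : ℕ}
    (L : EuclideanSpace ℝ (Fin d) ≃ₗ[ℝ] EuclideanSpace ℝ (Fin d)) (R : ℝ) :
    ∃ c, ∀ a, ∀ x ∈ L.toLinearMap '' coordCube d a,
      Metric.closedBall x R ⊆ L.toLinearMap '' coordCube d (a + c) := by
  let L' : EuclideanSpace ℝ (Fin d) →L[ℝ] EuclideanSpace ℝ (Fin d) :=
    L.symm.toLinearMap.toContinuousLinearMap
  refine ⟨2 * (‖L'‖ * R), ?_⟩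
  rintro a _ ⟨c, hc, rfl⟩ y hy
  refine ⟨L.symm y, fun i => ?_, by simp⟩
  have h1 : ‖L.symm y - c‖ ≤ ‖L'‖ * R := by
    calc ‖L.symm y - c‖ = ‖L' (y - L c)‖ := by simp [L']
      _ ≤ ‖L'‖ * ‖y - L c‖ := L'.le_opNorm _
      _ ≤ _ := by
        gcongr
        simpa [dist_eq_norm] using hy
  have h2 : |L.symm y i - c i| ≤ ‖L'‖ * R := (PiLp.norm_apply_le (L.symm y - c) i).trans h1
  have h3 := abs_add_le (L.symm y i - c i) (c i)
  have h4 := hc i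
  rw [sub_add_cancel] at h3
  linarith

theorem tendsto_volume_image_coordCube_ratio {d : ℕ}
    (L : EuclideanSpace ℝ (Fin d) ≃ₗ[ℝ] EuclideanSpace ℝ (Fin d)) (c : ℝ) :
    Tendsto (fun a => volume (L.toLinearMap '' coordCube d (a + c)) /
      volume (L.toLinearMap '' coordCube d a)) atTop (nhds 1) := by
  have hdet : ENNReal.ofReal |LinearMap.det L.toLinearMap| ≠ 0 := by
    simpa using L.isUnit_det'.ne_zero
  have h1 : Tendsto (fun a : ℝ => (a + c) / a) atTop (nhds 1) := by
    have : Tendsto (fun a : ℝ => 1 + c / a) atTop (nhds (1 + 0)) :=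
      tendsto_const_nhds.add (tendsto_const_nhds.div_atTop tendsto_id)
    rw [add_zero] at this
    refine this.congr' ?_
    filter_upwards [eventually_gt_atTop 0] with a ha
    field_simp
  have h2 : Tendsto (fun a : ℝ => ENNReal.ofReal ((a + c) / a) ^ d) atTop (nhds 1) := by
    have := ((ENNReal.continuous_pow d).tendsto _).comp (ENNReal.tendsto_ofReal h1)
    simpa [Function.comp_def] using this
  refine h2.congr' ?_
  filter_upwards [eventually_gt_atTop 0] with a ha
  rw [volume_image_coordCube, volume_image_coordCube,
    ENNReal.mul_div_mul_left _ _ hdet ENNReal.ofReal_ne_top, ENNReal.ofReal_div_of_pos ha,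
    div_eq_mul_inv, mul_pow, ← ENNReal.inv_pow, ← div_eq_mul_inv]

theorem exists_linearIsometry_range_eq {E : Type*} [NormedAddCommGroup E] [InnerProductSpace ℝ E]
    {d : ℕ} (W : Submodule ℝ E) [FiniteDimensional ℝ W] (hW : finrank ℝ W = d) :
    ∃ j : EuclideanSpace ℝ (Fin d) →ₗᵢ[ℝ] E, LinearMap.range j.toLinearMap = W := by
  let e := ((stdOrthonormalBasis ℝ W).reindex (finCongr hW)).repr.symm
  refine ⟨W.subtypeₗᵢ.comp e.toLinearIsometry, ?_⟩
  ext x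
  constructor
  · rintro ⟨z, rfl⟩
    exact (e z).2
  · intro hx
    exact ⟨e.symm ⟨x, hx⟩, by simp⟩

/-- Only the noise component in the subspace of the constellation matters for the decision. -/
theorem add_mem_voronoi_image_iff {V : Type*} [NormedAddCommGroup V] [InnerProductSpace ℝ V]
    [CompleteSpace V] {m T : ℕ} (j : V →ₗᵢ[ℝ] Signal m T) (X : Set V) (x : V) (n : Signal m T) :
    j x + n ∈ voronoi (j '' X) (j x) ↔
      x + ContinuousLinearMap.adjoint j.toContinuousLinearMap n ∈ voronoiCell X x := by
  set P := ContinuousLinearMap.adjoint j.toContinuousLinearMap with hP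
  simp only [voronoi, voronoiCell, forall_mem_image, mem_ofPred_eq]
  refine forall₂_congr fun s _ => ?_
  have h1 : inner ℝ (j (x - s)) n = inner ℝ (x - s) (P n) := by
    rw [hP, ContinuousLinearMap.adjoint_inner_right]
    rfl
  have h2 := norm_add_sq_real (j (x - s)) n
  have h3 := norm_add_sq_real (x - s) (P n)
  rw [j.norm_map, h1] at h2
  rw [dist_eq_norm, dist_eq_norm, dist_eq_norm, dist_eq_norm, add_sub_cancel_left,
    add_sub_cancel_left, add_sub_right_comm, add_sub_right_comm, ← map_sub,
    ← sq_le_sq₀ (norm_nonneg _) (norm_nonneg _), ← sq_le_sq₀ (norm_nonneg _) (norm_nonneg _),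
    h2, h3]
  constructor <;> intro h <;> linarith

theorem errorProb_image {V : Type*} [NormedAddCommGroup V] [InnerProductSpace ℝ V]
    [FiniteDimensional ℝ V] [MeasurableSpace V] [BorelSpace V] {N T : ℕ} {ρ : ℝ} (hρ : 0 < ρ)
    (j : V →ₗᵢ[ℝ] Signal N T) (X : Set V) (x : V) :
    errorProb ρ (j '' X) (j x) =
      gaussLaw V (Real.pi * Real.exp 1 * ρ) {z | x + z ∉ voronoiCell X x} := by
  rw [← map_adjoint_noise hρ j, Measure.map_apply (by fun_prop)]
  · rw [errorProb]
    congr 1 with n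
    exact not_congr (add_mem_voronoi_image_iff j X x n)
  · exact (((isClosed_voronoiCell X x).preimage
      (continuous_const.add continuous_id)).measurableSet).compl

/-- Coordinates at the receiver. There is an isometry `j` from `ℝ^{2l}` onto the complex span of the
received points, under which the image of the transmitter cube becomes the image of a coordinate cube
under an invertible linear map `L`, and the points in the transmitter cube are counted by the received
points `X` in this image. -/
theorem exists_receiver_coordinates {M N T l : ℕ} (H : Matrix (Fin N) (Fin M) ℂ)
    {S : Set (Signal M T)} {u : Fin (2 * l) → Signal M T}
    (hu : IsCubeFrame S u) (hH : IsComplexDim (extChannel T H '' S) l) :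
    ∃ (j : EuclideanSpace ℝ (Fin (2 * l)) →ₗᵢ[ℝ] Signal N T)
      (L : EuclideanSpace ℝ (Fin (2 * l)) ≃ₗ[ℝ] EuclideanSpace ℝ (Fin (2 * l)))
      (X : Set (EuclideanSpace ℝ (Fin (2 * l)))),
      extChannel T H '' S = j '' X ∧
      (∀ a, extChannel T H '' cube u a = j '' (L.toLinearMap '' coordCube (2 * l) a)) ∧
      ∀ a, numPoints S u a =
        ((X ∩ L.toLinearMap '' coordCube (2 * l) a).encard : ℝ≥0∞) := by
  set W := Submodule.span ℂ S with hW
  set f := extChannel T H with hf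
  set W' := Submodule.span ℂ (f '' S) with hW'
  have hmap : W' = W.map f := Submodule.span_image f
  obtain ⟨j, hj⟩ := exists_linearIsometry_range_eq (d := 2 * l) (W'.restrictScalars ℝ) (by
    have : finrank ℝ W' = 2 * finrank ℂ W' := finrank_real_of_complex W'
    rw [hH] at this
    exact this)
  have hj' : ∀ y ∈ W', ∃ z, j z = y := fun y hy => by
    have : y ∈ LinearMap.range j.toLinearMap := hj ▸ hy
    exact this
  let k : EuclideanSpace ℝ (Fin (2 * l)) →ₗ[ℝ] Signal M T :=
    (Fintype.linearCombination ℝ u).comp (WithLp.linearEquiv 2 ℝ (Fin (2 * l) → ℝ)).toLinearMap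
  have hk : ∀ c, k c = ∑ i, c i • u i := fun c => by
    simp [k, Fintype.linearCombination_apply]
  have hrange : ∀ w, w ∈ W ↔ ∃ c, k c = w := by
    intro w
    have h1 : w ∈ W ↔ w ∈ Submodule.span ℝ (range u) := by rw [hu.2]; rfl
    rw [h1, ← Fintype.range_linearCombination]
    constructor
    · rintro ⟨c, rfl⟩
      exact ⟨WithLp.toLp 2 c, rfl⟩
    · rintro ⟨c, rfl⟩
      exact ⟨WithLp.ofLp c, rfl⟩
  let P := ContinuousLinearMap.adjoint j.toContinuousLinearMap
  have hPj : ∀ z, P (j z) = z := fun z => by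
    refine ext_inner_right ℝ fun w => ?_
    rw [ContinuousLinearMap.adjoint_inner_left]
    exact j.inner_map_map z w
  have hjP : ∀ y ∈ W', j (P y) = y := fun y hy => by
    obtain ⟨z, rfl⟩ := hj' y hy
    rw [hPj]
  have hfk : ∀ c, f (k c) ∈ W' := fun c => by
    rw [hmap]
    exact ⟨k c, (hrange _).2 ⟨c, rfl⟩, rfl⟩
  let L₀ : EuclideanSpace ℝ (Fin (2 * l)) →ₗ[ℝ] EuclideanSpace ℝ (Fin (2 * l)) :=
    P.toLinearMap.comp ((f.restrictScalars ℝ).comp k)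
  have hL₀ : ∀ c, j (L₀ c) = f (k c) := fun c => hjP _ (hfk c)
  have hsurj : Function.Surjective L₀ := fun z => by
    have hz : j z ∈ W' := by
      have : j z ∈ LinearMap.range j.toLinearMap := ⟨z, rfl⟩
      rw [hj] at this
      exact this
    rw [hmap] at hz
    obtain ⟨w, hw, hwz⟩ := hz
    obtain ⟨c, rfl⟩ := (hrange w).1 hw
    exact ⟨c, j.injective ((hL₀ c).trans hwz)⟩
  -- The span of the received points also has real dimension `2l`, so surjectivity suffices.
  have hinj : Function.Injective L₀ := LinearMap.injective_iff_surjective.2 hsurj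
  let L := LinearEquiv.ofBijective L₀ ⟨hinj, hsurj⟩
  have hL : L.toLinearMap = L₀ := by ext; rfl
  have hSW : S ⊆ W := Submodule.subset_span
  have hfinj : InjOn f W := by
    rintro _ h1 _ h2 h
    obtain ⟨c, rfl⟩ := (hrange _).1 h1
    obtain ⟨c', rfl⟩ := (hrange _).1 h2
    rw [← hL₀, ← hL₀] at h
    rw [hinj (j.injective h)]
  have hcube : ∀ a, cube u a = k '' coordCube (2 * l) a := by
    intro a
    ext x
    constructor
    · rintro ⟨c, hc, rfl⟩
      exact ⟨WithLp.toLp 2 c, hc, hk _⟩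
    · rintro ⟨c, hc, rfl⟩
      exact ⟨WithLp.ofLp c, hc, hk _⟩
  have hcubeW : ∀ a, cube u a ⊆ W := by
    intro a
    rw [hcube]
    rintro _ ⟨c, _, rfl⟩
    exact (hrange _).2 ⟨c, rfl⟩
  have hX : f '' S = j '' (j ⁻¹' (f '' S)) := by
    rw [image_preimage_eq_of_subset]
    rintro y hy
    obtain ⟨z, hz⟩ := hj' y (Submodule.subset_span hy)
    exact ⟨z, hz⟩
  have hF : ∀ a, f '' cube u a = j '' (L.toLinearMap '' coordCube (2 * l) a) := by
    intro a
    rw [hcube, hL, image_image, image_image]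
    simp only [hL₀]
  refine ⟨j, L, j ⁻¹' (f '' S), hX, hF, fun a => ?_⟩
  rw [numPoints]
  congr 1
  rw [← (hfinj.mono (inter_subset_left.trans hSW : S ∩ cube u a ⊆ W)).encard_image,
    hfinj.image_inter hSW (hcubeW a), hF]
  conv_lhs => rw [hX]
  rw [← image_inter j.injective, j.injective.encard_image]

theorem euclideanHausdorffMeasure_image {d n T : ℕ}
    (j : EuclideanSpace ℝ (Fin d) →ₗᵢ[ℝ] Signal n T) (A : Set (EuclideanSpace ℝ (Fin d))) :
    (μHE[d] : Measure (Signal n T)) (j '' A) = volume A := by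
  rw [j.isometry.euclideanHausdorffMeasure_image,
    EuclideanSpace.euclideanHausdorffMeasure_eq_volume]

/-- The channel changes the density only by the finite, nonzero factor by which it scales volumes. -/
theorem exists_rxDensity_eq_mul_txDensity {M N T l : ℕ} (H : Matrix (Fin N) (Fin M) ℂ)
    {S : Set (Signal M T)} {u : Fin (2 * l) → Signal M T} (hu : IsCubeFrame S u)
    (hH : IsComplexDim (extChannel T H '' S) l) :
    ∃ D : ℝ≥0∞, D ≠ 0 ∧ D ≠ ⊤ ∧ rxDensity H S u = D * txDensity S u := by
  obtain ⟨j, L, X, -, hF, -⟩ := exists_receiver_coordinates H hu hH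
  have hdet : ENNReal.ofReal |LinearMap.det L.toLinearMap| ≠ 0 := by
    simpa using L.isUnit_det'.ne_zero
  refine ⟨(ENNReal.ofReal |LinearMap.det L.toLinearMap|)⁻¹, by simp, by simpa using hdet, ?_⟩
  rw [rxDensity, txDensity, ← ENNReal.limsup_const_mul_of_ne_top (by simpa using hdet)]
  refine limsup_congr ?_
  filter_upwards [eventually_ge_atTop 0] with a ha
  rw [hF, euclideanHausdorffMeasure_image, volume_image_coordCube, ENNReal.ofReal_pow ha,
    div_eq_mul_inv, div_eq_mul_inv, ENNReal.mul_inv (.inl hdet) (.inl ENNReal.ofReal_ne_top)]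
  ring

/-- The average error probability is at least the probability that `2l`-dimensional noise leaves the
ball whose volume is the volume per received point. -/
theorem gaussLaw_compl_closedBall_le_avgErrorProb {M N T l : ℕ} {ρ : ℝ} (hρ : 0 < ρ)
    (H : Matrix (Fin N) (Fin M) ℂ) {S : Set (Signal M T)} {u : Fin (2 * l) → Signal M T}
    (hu : IsCubeFrame S u) (hH : IsComplexDim (extChannel T H '' S) l)
    (hrx0 : rxDensity H S u ≠ 0) (hrx1 : rxDensity H S u ≠ ⊤) {r : ℝ}
    (hr : volume (Metric.closedBall (0 : EuclideanSpace ℝ (Fin (2 * l))) r) =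
      (rxDensity H S u)⁻¹) :
    gaussLaw (EuclideanSpace ℝ (Fin (2 * l))) (Real.pi * Real.exp 1 * ρ)
      (Metric.closedBall 0 r)ᶜ ≤ avgErrorProb ρ H S u := by
  obtain ⟨j, L, X, hX, hF, hn⟩ := exists_receiver_coordinates H hu hH
  have hdet : ENNReal.ofReal |LinearMap.det L.toLinearMap| ≠ 0 := by
    simpa using L.isUnit_det'.ne_zero
  have hb : 0 < Real.pi * Real.exp 1 * ρ := by positivity
  set b := Real.pi * Real.exp 1 * ρ
  have hprob := isProbabilityMeasure_gaussLaw (V := EuclideanSpace ℝ (Fin (2 * l))) hb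
  rw [gaussLaw] at hprob
  have hmono : ∀ s t : ℝ, 0 ≤ s → s ≤ t → Real.exp (-b * t ^ 2) ≤ Real.exp (-b * s ^ 2) := by
    intro s t hs hst
    apply Real.exp_le_exp.2
    have := mul_le_mul_of_nonneg_left (pow_le_pow_left₀ hs hst 2) hb.le
    linarith
  -- A negative radius would give the empty ball and hence infinite density.
  have hr0 : 0 ≤ r := by
    by_contra h
    rw [Metric.closedBall_eq_empty.2 (not_le.1 h), measure_empty] at hr
    exact hrx1 (ENNReal.inv_eq_zero.1 hr.symm)
  have key := le_limsup_average_error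
    (φ := fun z => ENNReal.ofReal (gaussDensity (EuclideanSpace ℝ (Fin (2 * l))) b z))
    (κ := ENNReal.ofReal ((b / Real.pi) ^
      (finrank ℝ (EuclideanSpace ℝ (Fin (2 * l))) / 2 : ℝ) * Real.exp (-b * r ^ 2)))
    (B := Metric.closedBall 0 r) Metric.isClosed_closedBall.measurableSet
    (fun z hz => ENNReal.ofReal_le_ofReal (by
      unfold gaussDensity
      gcongr ?_ * ?_
      exact hmono _ _ (norm_nonneg z) (by simpa using hz)))
    (fun z hz => ENNReal.ofReal_le_ofReal (by
      unfold gaussDensity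
      gcongr ?_ * ?_
      exact hmono _ _ hr0 (by simpa using (not_le.1 (by simpa using hz) : r < ‖z‖).le)))
    ENNReal.ofReal_ne_top (by rw [hr]; simpa using hrx1) (by rw [hr]; simpa using hrx0) X
    (fun a => L.toLinearMap '' coordCube (2 * l) a) (closedBall_subset_image_coordCube L)
    (by
      filter_upwards [eventually_gt_atTop 0] with a ha
      rw [volume_image_coordCube]
      exact mul_ne_zero hdet (pow_ne_zero _ (by simpa using ha)))
    (fun a => by
      rw [volume_image_coordCube]
      exact ENNReal.mul_ne_top ENNReal.ofReal_ne_top (ENNReal.pow_ne_top ENNReal.ofReal_ne_top))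
    (tendsto_volume_image_coordCube_ratio L)
    (by
      rw [hr, inv_inv, rxDensity]
      simp only [hF, euclideanHausdorffMeasure_image, hn])
  refine key.trans (le_of_eq ?_)
  rw [avgErrorProb]
  congr 1 with a
  rw [hn a, hX, hF, ← image_inter j.injective,
    tsum_image (fun y => errorProb ρ (j '' X) y) j.injective.injOn]
  simp only [errorProb_image hρ]
  rfl

end MIMO

theorem theorem1 (M N T l : ℕ) (hl : 0 < l) (K r ρ : ℝ) (hK : K * (T : ℝ) = (l : ℝ))
    (hr : 0 ≤ r) (hrK : r ≤ K) (hρ : 0 < ρ)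
    (H : Matrix (Fin N) (Fin M) ℂ)
    (S : Set (MIMO.Signal M T)) (hS : MIMO.IsComplexDim S l)
    (u : Fin (2 * l) → MIMO.Signal M T) (hu : MIMO.IsCubeFrame S u)
    (hdens : MIMO.txDensity S u = ENNReal.ofReal (ρ ^ (r * (T : ℝ))))
    (hH : MIMO.IsComplexDim (MIMO.extChannel T H '' S) l) :
    ENNReal.ofReal
        (MIMO.boundC (K * T) / 4 *
          Real.exp (-MIMO.rxVNR ρ H S u * MIMO.boundA (K * T) +
            (K * T - 1) * Real.log (MIMO.rxVNR ρ H S u)))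
      < MIMO.avgErrorProb ρ H S u := by
  obtain ⟨D, hD0, hD1, hD⟩ := MIMO.exists_rxDensity_eq_mul_txDensity H hu hH
  have hg0 : MIMO.rxDensity H S u ≠ 0 := by
    rw [hD, hdens]
    exact mul_ne_zero hD0 (by simpa using Real.rpow_pos_of_pos hρ _)
  have hg1 : MIMO.rxDensity H S u ≠ ⊤ := by
    rw [hD, hdens]
    exact ENNReal.mul_ne_top hD1 ENNReal.ofReal_ne_top
  obtain ⟨k, rfl⟩ : ∃ k, l = k + 1 := ⟨l - 1, by omega⟩
  rw [hK]
  set g := (MIMO.rxDensity H S u).toReal with hg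
  have hgpos : 0 < g := ENNReal.toReal_pos hg0 hg1
  set n : ℝ := ((k + 1 : ℕ) : ℝ) with hn
  have hnpos : 0 < n := by positivity
  have hfac : Real.Gamma (n + 1) = (k + 1).factorial := Real.Gamma_nat_eq_factorial (k + 1)
  have hGpos : 0 < Real.Gamma (n + 1) := by rw [hfac]; positivity
  have hm : MIMO.rxVNR ρ H S u = ρ * g ^ (-(1 / n)) := by
    rw [MIMO.rxVNR, MIMO.noiseVar]
    field_simp
    rw [hg, hn]
  -- `s` is the squared radius of the ball of volume `g⁻¹` in real dimension `2 (k + 1)`.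
  set s : ℝ := Real.Gamma (n + 1) ^ (1 / n) * g ^ (-(1 / n)) / Real.pi with hs
  have hspos : 0 < s := by positivity
  have hroot : ∀ x : ℝ, 0 < x → (x ^ (1 / n)) ^ (k + 1) = x := fun x hx => by
    rw [← Real.rpow_natCast, ← Real.rpow_mul hx.le, one_div_mul_cancel hnpos.ne', Real.rpow_one]
  have hspow : s ^ (k + 1) * (Real.pi ^ (k + 1) / (k + 1).factorial) = g⁻¹ := by
    rw [hs, div_pow, mul_pow, hroot _ hGpos, Real.rpow_neg hgpos.le, inv_pow, hroot _ hgpos, hfac]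
    field_simp
  have hball : volume (Metric.closedBall (0 : EuclideanSpace ℝ (Fin (2 * (k + 1)))) √s) =
      (MIMO.rxDensity H S u)⁻¹ := by
    have : Nontrivial (EuclideanSpace ℝ (Fin (2 * (k + 1)))) :=
      Module.nontrivial_of_finrank_pos (R := ℝ) (by simp)
    rw [InnerProductSpace.volume_closedBall_of_dim_even (k := k + 1) (by simp),
      ← ENNReal.ofReal_pow (by positivity), ← ENNReal.ofReal_mul (by positivity),
      finrank_euclideanSpace_fin, pow_mul, Real.sq_sqrt hspos.le, hspow,
      ENNReal.ofReal_inv_of_pos hgpos, hg, ENNReal.ofReal_toReal hg1]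
  have ht : Real.pi * Real.exp 1 * ρ * √s ^ 2 = MIMO.rxVNR ρ H S u * MIMO.boundA n := by
    rw [Real.sq_sqrt hspos.le, hm, hs, MIMO.boundA]
    field_simp
  refine lt_of_lt_of_le ?_ ((MIMO.gaussLaw_compl_closedBall_ge (k := k) (by simp) (by positivity)
    (Real.sqrt_nonneg s)).trans (MIMO.gaussLaw_compl_closedBall_le_avgErrorProb
      hρ H hu hH hg0 hg1 hball))
  have hmpos : 0 < MIMO.rxVNR ρ H S u := by rw [hm]; positivity
  have hlt := MIMO.bound_lt hmpos ht
  refine (ENNReal.ofReal_lt_ofReal_iff ?_).2 hlt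
  rw [ht]
  have : 0 < MIMO.boundA n := by unfold MIMO.boundA; positivity
  positivity
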